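/- Let $G$ be a finite connected simple bipartite graph on $n\ge 6$ vertices, and suppose that for every pair of distinct non-adjacent vertices $u,v$ we have $\mathrm{val}(u)+\mathrm{val}(v)\ge 2\lfloor n/4\rfloor+3$, where $\mathrm{val}$ denotes the valence (degree). Then $$\mathrm{sn}(G)=\mathrm{gon}(G)=n-\alpha_2^c(G).$$ Here $\mathrm{sn}(G)$, $\mathrm{gon}(G)$ and $\alpha^c_2(G)$ are defined as follows. A scramble on $G$ is a collection $\mathcal S$ of vertex sets, called eggs, each inducing a (non-empty) connected subgraph. Let $h(\mathcal S)$ be the minimum size of a set $C\subseteq V(G)$ meeting every egg. Let $e(\mathcal S)$ be the minimum number of edges between $A$ and $V(G)\setminus A$ over all $A\subseteq V(G)$ such that $A$ and $V(G)\setminus A$ each contain an egg, with $e(\mathcal S)=\infty$ if there is no such $A$. The order of $\mathcal S$ is $\min(h(\mathcal S),e(\mathcal S))$, and the scramble number $\mathrm{sn}(G)$ is the maximum order of a scramble on $G$. A divisor on $G$ is a function $D:V(G)\to\mathbb Z$; its degree is $\sum_v D(v)$, and it is effective if $D\ge 0$. The chip-firing move at $v$ lowers $D(v)$ by $\mathrm{val}(v)$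 and raises $D(w)$ by $1$ for each neighbour $w$ of $v$; two divisors are equivalent if one can be transformed into the other by a finite sequence of such moves. The rank of $D$ is $-1$ if $D$ is not equivalent to an effective divisor, and otherwise it is the largest integer $r\ge 0$ such that $D-E$ is equivalent to an effective divisor for every effective divisor $E$ of degree $r$. The gonality $\mathrm{gon}(G)$ is the minimum degree of a divisor of positive rank. Finally, $\alpha_2^c(G)$ is the maximum size of a set $S\subseteq V(G)$ such that every connected component of the induced subgraph $G[S]$ has at most $2$ vertices. -/

import Mathlib

/-! Scrambles, component independence and divisors on a finite simple graph. -/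

namespace GraphGonality

variable {V : Type*} [Fintype V] [DecidableEq V]

/-- A scramble on `G`: a collection of connected (in particular non-empty) vertex sets, its eggs. -/
structure Scramble (G : SimpleGraph V) where
  /-- The eggs of the scramble. -/
  eggs : Finset (Finset V)
  /-- Every egg induces a connected subgraph. -/
  connected_of_mem : ∀ E ∈ eggs, (G.induce (E : Set V)).Connected

namespace Scramble

variable {G : SimpleGraph V}

/-- `C` is a hitting set of `S` if it meets every egg. -/
def IsHittingSet (S : Scramble G) (C : Finset V) : Prop :=
  ∀ E ∈ S.eggs, (C ∩ E).Nonempty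

/-- `A` is an egg-cut of `S` if `A` and its complement each contain an egg. -/
def IsEggCut (S : Scramble G) (A : Finset V) : Prop :=
  (∃ E ∈ S.eggs, E ⊆ A) ∧ (∃ E ∈ S.eggs, E ⊆ Aᶜ)

/-- `h(S)`, the minimum size of a hitting set. -/
noncomputable def hittingNumber (S : Scramble G) : ℕ∞ :=
  ⨅ (C : Finset V) (_ : S.IsHittingSet C), (C.card : ℕ∞)

/-- `e(S)`, the minimum of `|E(A, Aᶜ)|` over all egg-cuts `A`; it is `∞` if there is no egg-cut.
As `A` and `Aᶜ` are disjoint, `G.interedges A Aᶜ` has one pair for each edge between them. -/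
noncomputable def eggCutNumber [DecidableRel G.Adj] (S : Scramble G) : ℕ∞ :=
  ⨅ (A : Finset V) (_ : S.IsEggCut A), ((G.interedges A Aᶜ).card : ℕ∞)

/-- The order `‖S‖ = min (h(S), e(S))` of a scramble. -/
noncomputable def order [DecidableRel G.Adj] (S : Scramble G) : ℕ∞ :=
  min S.hittingNumber S.eggCutNumber

end Scramble

/-- The scramble number `sn(G)`, the maximum order of a scramble on `G`. -/
noncomputable def scrambleNumber (G : SimpleGraph V) [DecidableRel G.Adj] : ℕ∞ :=
  ⨆ S : Scramble G, S.order

/-- `S` is `ℓ`-component independent if all components of `G[S]` have at most `ℓ` vertices. -/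
def IsComponentIndependent (G : SimpleGraph V) (ℓ : ℕ) (S : Finset V) : Prop :=
  ∀ C : (G.induce (S : Set V)).ConnectedComponent, C.supp.ncard ≤ ℓ

open Classical in
/-- `α^c_ℓ(G)`, the maximum size of an `ℓ`-component independent set. -/
noncomputable def componentIndepNumber (G : SimpleGraph V) (ℓ : ℕ) : ℕ :=
  (Finset.univ.filter fun S : Finset V => IsComponentIndependent G ℓ S).sup Finset.card

/-- The degree of a divisor `D : V → ℤ`. -/
def divisorDegree (D : V → ℤ) : ℤ := ∑ v, D v

/-- A divisor is effective if all of its coefficients are non-negative. -/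
def IsEffective (D : V → ℤ) : Prop := ∀ v, 0 ≤ D v

/-- The chip-firing move at `v`: the vertex `v` loses `val(v)` chips and each neighbour of `v`
gains one chip. -/
def chipFire (G : SimpleGraph V) [DecidableRel G.Adj] (v : V) (D : V → ℤ) : V → ℤ :=
  fun w => if w = v then D w - (G.degree v : ℤ) else if G.Adj v w then D w + 1 else D w

/-- `D ∼ D'`: the divisor `D` can be transformed into `D'` by a finite sequence of chip-firing
moves. -/
def DivisorEquiv (G : SimpleGraph V) [DecidableRel G.Adj] : (V → ℤ) → (V → ℤ) → Prop :=
  Relation.ReflTransGen fun D D' => ∃ v, D' = chipFire G v D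

/-- `D` is equivalent to some effective divisor. -/
def IsWinnable (G : SimpleGraph V) [DecidableRel G.Adj] (D : V → ℤ) : Prop :=
  ∃ F, IsEffective F ∧ DivisorEquiv G D F

open Classical in
/-- The rank of a divisor: `-1` if `D` is not equivalent to an effective divisor, and otherwise the
largest `r ≥ 0` such that `D - E` is equivalent to an effective divisor for every effective `E` of
degree `r`. (If `V` is non-empty, such `r` are at most the degree of `D`.) -/
noncomputable def divisorRank (G : SimpleGraph V) [DecidableRel G.Adj] (D : V → ℤ) : ℤ :=
  if IsWinnable G D then
    ((sSup {r : ℕ | ∀ E : V → ℤ, IsEffective E → divisorDegree E = r → IsWinnable G (D - E)} : ℕ)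
      : ℤ)
  else -1

/-- The divisorial gonality `gon(G)`, the minimum degree of a divisor of positive rank. (Such a
divisor is equivalent to an effective one, so its degree is a natural number.) -/
noncomputable def gonality (G : SimpleGraph V) [DecidableRel G.Adj] : ℕ :=
  sInf {d : ℕ | ∃ D : V → ℤ, divisorDegree D = d ∧ 0 < divisorRank G D}

end GraphGonality

/-! The chain $n-\alpha_2^c\le\mathrm{sn}\le\mathrm{gon}\le n-\alpha_2^c$ closes up. Upper bound
(`reachesAll_indicator_compl`): put one chip on each vertex outside a maximum 2-component
independent set $S$. Firing everything except a component of $G[S]$ moves chips onto it; a vertex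
outside $S$ loses at most one chip because bipartite graphs have no triangles. The inequality
$\mathrm{sn}\le\mathrm{gon}$ (`order_le_divisorDegree`) holds on every graph: either some divisor of
the given degree meets all eggs, or moving chips to a missed egg passes through an egg-cut no larger
than the degree. Lower bound (`le_order_largeScramble`): take all connected sets of at least 3
vertices as eggs. The complement of a hitting set is 2-component independent. The valence condition
makes every egg-cut at least $2\lfloor n/4\rfloor+1\ge\lfloor n/2\rfloor$, and
$n-\alpha_2^c\le\lfloor n/2\rfloor$ since a colour class is independent. -/

set_option linter.unusedSectionVars false

namespace GraphGonality

variable {V : Type*} [Fintype V] [DecidableEq V]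

/-! ### Chip-firing through the Laplacian, and positive rank. -/

section Laplacian

variable (G : SimpleGraph V) [DecidableRel G.Adj]

/-- The graph Laplacian on integer-valued functions. -/
def lap (f : V → ℤ) : V → ℤ := fun v => ∑ w ∈ G.neighborFinset v, (f v - f w)

lemma lap_add (f g : V → ℤ) : lap G (f + g) = lap G f + lap G g := by
  funext v
  simp only [lap, Pi.add_apply, ← Finset.sum_add_distrib]
  exact Finset.sum_congr rfl fun _ _ => by ring

lemma lap_neg (f : V → ℤ) : lap G (-f) = -lap G f := by
  funext v
  simp only [lap, Pi.neg_apply, ← Finset.sum_neg_distrib]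
  exact Finset.sum_congr rfl fun _ _ => by ring

lemma lap_const (c : ℤ) : lap G (fun _ => c) = 0 := by
  funext v
  simp [lap]

lemma lap_zero : lap G 0 = 0 := lap_const G 0

lemma sum_lap (f : V → ℤ) : ∑ v, lap G f v = 0 := by
  have h : ∀ v, lap G f v = ∑ w, if G.Adj v w then f v - f w else 0 := fun v => by
    rw [lap, ← Finset.sum_filter]
    exact Finset.sum_congr (by ext; simp) fun _ _ => rfl
  simp only [h]
  have h2 : (∑ v, ∑ w, if G.Adj v w then f v - f w else 0)
      = -∑ v, ∑ w, if G.Adj v w then f v - f w else 0 := by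
    conv_lhs => rw [Finset.sum_comm]
    simp only [← Finset.sum_neg_distrib]
    refine Finset.sum_congr rfl fun v _ => Finset.sum_congr rfl fun w _ => ?_
    by_cases hvw : G.Adj v w
    · simp [hvw, hvw.symm]
    · simp [hvw, G.adj_comm w v]
  linarith

lemma divisorDegree_sub_lap (D f : V → ℤ) :
    divisorDegree (D - lap G f) = divisorDegree D := by
  simp [divisorDegree, Finset.sum_sub_distrib, sum_lap]

lemma lap_single_self (v : V) : lap G (Pi.single v 1) v = G.degree v := by
  rw [lap, ← G.card_neighborFinset_eq_degree, Finset.card_eq_sum_ones, Nat.cast_sum]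
  refine Finset.sum_congr rfl fun w hw => ?_
  have hne : w ≠ v := ((G.mem_neighborFinset v w).1 hw).ne'
  simp [hne]

lemma lap_single_of_ne {v w : V} (h : w ≠ v) :
    lap G (Pi.single v 1) w = if G.Adj v w then -1 else 0 := by
  have : ∀ x, (Pi.single v (1 : ℤ) : V → ℤ) w - (Pi.single v 1 : V → ℤ) x
      = if x = v then -1 else 0 := fun x => by
    by_cases hx : x = v
    · subst hx; simp [h]
    · simp [h, hx]
  simp only [lap, this, Finset.sum_ite_eq', SimpleGraph.mem_neighborFinset, G.adj_comm w v]

lemma chipFire_eq (v : V) (D : V → ℤ) :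
    chipFire G v D = D - lap G (Pi.single v 1) := by
  funext w
  by_cases h : w = v
  · subst h; simp [chipFire, lap_single_self]
  · by_cases h' : G.Adj v w <;> simp [chipFire, h, h', lap_single_of_ne]

lemma exists_lap_of_divisorEquiv {D D' : V → ℤ} (h : DivisorEquiv G D D') :
    ∃ f, D' = D - lap G f := by
  induction h with
  | refl => exact ⟨0, by simp [lap_zero]⟩
  | tail _ h ih =>
    obtain ⟨f, rfl⟩ := ih
    obtain ⟨v, rfl⟩ := h
    exact ⟨f + Pi.single v 1, by rw [chipFire_eq, lap_add]; abel⟩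

lemma divisorEquiv_sub_lap_of_nonneg (f : V → ℕ) (D : V → ℤ) :
    DivisorEquiv G D (D - lap G (fun v => (f v : ℤ))) := by
  induction hs : ∑ v, f v generalizing f D with
  | zero =>
    have : (fun v => (f v : ℤ)) = 0 := by
      funext v
      simpa using (Finset.sum_eq_zero_iff.1 hs) v (Finset.mem_univ v)
    rw [this, lap_zero, sub_zero]
    exact Relation.ReflTransGen.refl
  | succ m ih =>
    obtain ⟨v, -, hv⟩ : ∃ v ∈ Finset.univ, f v ≠ 0 := by
      by_contra! hcon
      rw [Finset.sum_eq_zero hcon] at hs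
      omega
    obtain ⟨g, hg⟩ : ∃ g : V → ℕ, f = g + Pi.single v 1 := by
      refine ⟨f - Pi.single v 1, ?_⟩
      funext w
      by_cases h : w = v
      · subst h; simp; omega
      · simp [h]
    have hgs : ∑ w, g w = m := by
      rw [hg] at hs
      simp only [Pi.add_apply, Finset.sum_add_distrib] at hs
      rw [Finset.sum_pi_single'] at hs
      simpa using hs
    have hcast : (fun w => (f w : ℤ)) = (fun w => (g w : ℤ)) + Pi.single v 1 := by
      funext w
      rw [hg]
      by_cases h : w = v
      · subst h; simp
      · simp [h]
    refine Relation.ReflTransGen.tail (ih g D hgs) ⟨v, ?_⟩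
    rw [chipFire_eq, hcast, lap_add]
    abel

/-- Moves cannot be undone one at a time, but constants have zero Laplacian, so adding one makes all
firing counts non-negative. -/
lemma divisorEquiv_sub_lap (f D : V → ℤ) : DivisorEquiv G D (D - lap G f) := by
  obtain ⟨c, hc⟩ : ∃ c : ℤ, ∀ v, 0 ≤ f v + c :=
    ⟨∑ v, |f v|, fun v => by
      have := Finset.single_le_sum (f := fun v => |f v|) (fun v _ => abs_nonneg _)
        (Finset.mem_univ v)
      have := neg_abs_le (f v)
      linarith⟩
  have h := divisorEquiv_sub_lap_of_nonneg G (fun v => (f v + c).toNat) D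
  have e : (fun v => (((f v + c).toNat : ℕ) : ℤ)) = f + fun _ => c := by
    funext v
    simp [hc v]
  rwa [e, lap_add, lap_const, add_zero] at h

lemma isWinnable_iff (D : V → ℤ) : IsWinnable G D ↔ ∃ f, IsEffective (D - lap G f) := by
  constructor
  · rintro ⟨F, hF, h⟩
    obtain ⟨f, rfl⟩ := exists_lap_of_divisorEquiv G h
    exact ⟨f, hF⟩
  · rintro ⟨f, hf⟩
    exact ⟨_, hf, divisorEquiv_sub_lap G f D⟩

/-- Every vertex carries a chip in some effective divisor equivalent to `D`. -/
def ReachesAll (D : V → ℤ) : Prop :=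
  ∀ v, ∃ f, IsEffective (D - lap G f) ∧ 1 ≤ (D - lap G f) v

lemma ReachesAll.sub_lap {D : V → ℤ} (h : ReachesAll G D) (f : V → ℤ) :
    ReachesAll G (D - lap G f) := fun v => by
  obtain ⟨g, hg⟩ := h v
  refine ⟨g + -f, ?_⟩
  rw [lap_add, lap_neg]
  have : D - lap G f - (lap G g + -lap G f) = D - lap G g := by abel
  rwa [this]

lemma reachesAll_of_rank_pos {D : V → ℤ} (h : 0 < divisorRank G D) : ReachesAll G D := by
  classical
  unfold divisorRank at h
  split_ifs at h with hw
  · set R := {r : ℕ | ∀ E : V → ℤ, IsEffective E → divisorDegree E = r → IsWinnable G (D - E)}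
    have hpos : 0 < sSup R := by exact_mod_cast h
    -- On `ℕ`, `sSup` is 0 for an empty or unbounded set, so a positive value is attained; that
    -- value is then used with all of $E$ on $v$.
    have hb : BddAbove R := by
      by_contra hb
      rw [Nat.sSup_of_not_bddAbove hb] at hpos
      exact lt_irrefl _ hpos
    have hne : R.Nonempty := by
      by_contra hne
      rw [Set.not_nonempty_iff_eq_empty.1 hne] at hpos
      simp at hpos
    have hm := Nat.sSup_mem hne hb
    intro v
    obtain ⟨f, hf⟩ := (isWinnable_iff G _).1 (hm (Pi.single v ((sSup R : ℕ) : ℤ))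
      (fun w => by
        by_cases hwv : w = v
        · subst hwv; simp
        · simp [hwv]) (by simp [divisorDegree]))
    refine ⟨f, fun w => ?_, ?_⟩
    · have := hf w
      by_cases hwv : w = v
      · subst hwv
        simp at this ⊢
        omega
      · simpa [hwv] using this
    · have := hf v
      simp at this ⊢
      omega
  · omega

lemma rank_pos_of_reachesAll [Nonempty V] {D : V → ℤ} (h : ReachesAll G D) :
    0 < divisorRank G D := by
  classical
  obtain ⟨v₀⟩ := ‹Nonempty V›
  have hw : IsWinnable G D := by
    obtain ⟨f, hf, -⟩ := h v₀
    exact (isWinnable_iff G D).2 ⟨f, hf⟩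
  unfold divisorRank
  rw [if_pos hw]
  -- An unbounded set would give rank 0 by default; taking $E=r\cdot v_0$ shows $r\le\deg D$.
  have hb : BddAbove
      {r : ℕ | ∀ E : V → ℤ, IsEffective E → divisorDegree E = r → IsWinnable G (D - E)} := by
    refine ⟨(divisorDegree D).toNat, fun r hr => ?_⟩
    obtain ⟨f, hf⟩ := (isWinnable_iff G _).1 (hr (Pi.single v₀ (r : ℤ))
      (fun w => by
        by_cases hwv : w = v₀
        · subst hwv; simp
        · simp [hwv]) (by simp [divisorDegree]))
    have h1 : 0 ≤ divisorDegree (D - Pi.single v₀ (r : ℤ) - lap G f) :=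
      Finset.sum_nonneg fun v _ => hf v
    rw [divisorDegree_sub_lap] at h1
    have h2 : divisorDegree (D - Pi.single v₀ (r : ℤ)) = divisorDegree D - r := by
      simp [divisorDegree, Finset.sum_sub_distrib]
    omega
  have h1 := le_csSup hb (show 1 ∈ _ from fun E hE hdeg => by
    obtain ⟨v, -, hv⟩ : ∃ v ∈ Finset.univ, E v ≠ 0 := by
      by_contra! hcon
      rw [divisorDegree, Finset.sum_eq_zero hcon] at hdeg
      norm_num at hdeg
    have hle : ∀ w, E w ≤ if w = v then 1 else 0 := fun w => by
      split_ifs with hwv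
      · subst hwv
        calc E w ≤ ∑ x, E x := Finset.single_le_sum (fun x _ => hE x) (Finset.mem_univ w)
          _ = 1 := by exact_mod_cast hdeg
      · have : E v + E w ≤ ∑ x, E x := by
          rw [← Finset.sum_pair (Ne.symm hwv)]
          exact Finset.sum_le_sum_of_subset_of_nonneg (Finset.subset_univ _) fun x _ _ => hE x
        have h3 : ∑ x, E x = 1 := by exact_mod_cast hdeg
        have := hE v
        omega
    obtain ⟨f, hf, hfv⟩ := h v
    refine (isWinnable_iff G _).2 ⟨f, fun w => ?_⟩
    have h4 := hle w
    have h5 := hf w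
    simp only [Pi.sub_apply] at h5 hfv ⊢
    split_ifs at h4 with hwv
    · subst hwv; omega
    · omega)
  exact_mod_cast h1

end Laplacian

/-! ### The scramble number is at most the gonality. -/

section ScrambleBound

variable (G : SimpleGraph V) [DecidableRel G.Adj]

/-- A connected set meeting `U` and its complement contains an edge between them. -/
lemma exists_adj_of_connected {E : Finset V} (hE : (G.induce (E : Set V)).Connected) {U : Set V}
    {x y : V} (hx : x ∈ E) (hxU : x ∈ U) (hy : y ∈ E) (hyU : y ∉ U) :
    ∃ a ∈ E, ∃ b ∈ E, a ∈ U ∧ b ∉ U ∧ G.Adj a b := by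
  obtain ⟨p⟩ := hE.preconnected ⟨x, hx⟩ ⟨y, hy⟩
  obtain ⟨d, -, h1, h2⟩ := p.exists_boundary_dart (Subtype.val ⁻¹' U) hxU hyU
  exact ⟨d.fst, d.fst.2, d.snd, d.snd.2, h1, h2, d.adj⟩

lemma lap_indicator_of_mem {U : Finset V} {v : V} (hv : v ∈ U) :
    lap G (fun w => if w ∈ U then 1 else 0) v = ((G.neighborFinset v).filter (· ∉ U)).card := by
  rw [lap, Finset.card_filter, Nat.cast_sum]
  refine Finset.sum_congr rfl fun w _ => ?_
  by_cases hw : w ∈ U <;> simp [hv, hw]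

lemma lap_indicator_of_notMem {U : Finset V} {v : V} (hv : v ∉ U) :
    lap G (fun w => if w ∈ U then 1 else 0) v = -((G.neighborFinset v).filter (· ∈ U)).card := by
  rw [lap, Finset.card_filter, Nat.cast_sum, ← Finset.sum_neg_distrib]
  refine Finset.sum_congr rfl fun w _ => ?_
  by_cases hw : w ∈ U <;> simp [hv, hw]

lemma card_interedges_compl (X : Finset V) :
    (G.interedges X Xᶜ).card = ∑ v ∈ X, ((G.neighborFinset v).filter (· ∉ X)).card := by
  rw [SimpleGraph.interedges, Rel.interedges, Finset.card_filter, Finset.sum_product]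
  refine Finset.sum_congr rfl fun v _ => ?_
  rw [← Finset.card_filter]
  congr 1
  ext w
  simp [and_comm]

/-- `D` has a chip on `E`. -/
def Hits (D : V → ℤ) (E : Finset V) : Prop := ∃ v ∈ E, 0 < D v

variable {G}

/-- If firing `U` makes a connected set carry chips, that set is disjoint from `U`. -/
lemma notMem_of_gains {D : V → ℤ} {U E : Finset V}
    (hD : IsEffective D) (hD' : IsEffective (D - lap G fun w => if w ∈ U then 1 else 0))
    (hE : (G.induce (E : Set V)).Connected) (h : ¬ Hits D E)
    (h' : Hits (D - lap G fun w => if w ∈ U then 1 else 0) E) : ∀ v ∈ E, v ∉ U := by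
  intro x hx hxU
  obtain ⟨y, hy, hy'⟩ := h'
  have h0 : ∀ v ∈ E, D v = 0 := fun v hv =>
    le_antisymm (not_lt.1 fun hlt => h ⟨v, hv, hlt⟩) (hD v)
  have hyU : y ∉ U := fun hyU => by
    rw [Pi.sub_apply, lap_indicator_of_mem G hyU, h0 y hy] at hy'
    omega
  obtain ⟨a, ha, b, -, haU, hbU, hab⟩ :=
    exists_adj_of_connected G hE (U := (U : Set V)) hx hxU hy hyU
  have h1 := hD' a
  rw [Pi.sub_apply, lap_indicator_of_mem G haU, h0 a ha] at h1
  have : 0 < ((G.neighborFinset a).filter (· ∉ U)).card :=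
    Finset.card_pos.2 ⟨b, by simpa [hab] using hbU⟩
  omega

/-- If firing `U` removes all chips from a connected set, that set is contained in `U`. -/
lemma mem_of_loses {D : V → ℤ} {U E : Finset V}
    (hD : IsEffective D) (hD' : IsEffective (D - lap G fun w => if w ∈ U then 1 else 0))
    (hE : (G.induce (E : Set V)).Connected) (h : Hits D E)
    (h' : ¬ Hits (D - lap G fun w => if w ∈ U then 1 else 0) E) : ∀ v ∈ E, v ∈ U := by
  intro y hy
  by_contra hyU
  obtain ⟨x, hx, hx'⟩ := h
  have h0 : ∀ v ∈ E, (D - lap G fun w => if w ∈ U then 1 else 0) v = 0 := fun v hv =>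
    le_antisymm (not_lt.1 fun hlt => h' ⟨v, hv, hlt⟩) (hD' v)
  have hxU : x ∈ U := by
    by_contra hxU
    have := h0 x hx
    rw [Pi.sub_apply, lap_indicator_of_notMem G hxU] at this
    omega
  obtain ⟨a, -, b, hb, haU, hbU, hab⟩ :=
    exists_adj_of_connected G hE (U := (U : Set V)) hx hxU hy hyU
  have h1 := h0 b hb
  rw [Pi.sub_apply, lap_indicator_of_notMem G hbU] at h1
  have : 0 < ((G.neighborFinset b).filter (· ∈ U)).card :=
    Finset.card_pos.2 ⟨a, by simpa [hab.symm] using haU⟩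
  have := hD b
  omega

/-- A vertex of $U$ sends a chip along each of its edges leaving $U$ and receives none, so it must
already hold that many. -/
lemma card_interedges_le_divisorDegree {D : V → ℤ} {U : Finset V}
    (hD : IsEffective D) (hD' : IsEffective (D - lap G fun w => if w ∈ U then 1 else 0)) :
    ((G.interedges U Uᶜ).card : ℤ) ≤ divisorDegree D := by
  rw [card_interedges_compl, Nat.cast_sum]
  calc ∑ v ∈ U, (((G.neighborFinset v).filter (· ∉ U)).card : ℤ) ≤ ∑ v ∈ U, D v := by
        refine Finset.sum_le_sum fun v hv => ?_
        have := hD' v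
        rw [Pi.sub_apply, lap_indicator_of_mem G hv] at this
        omega
    _ ≤ divisorDegree D :=
        Finset.sum_le_sum_of_subset_of_nonneg (Finset.subset_univ _) fun v _ _ => hD v

/-- Two effective divisors `D` and `D - lap f` are joined by effective divisors obtained from
truncations of `f`. -/
lemma isEffective_sub_lap_trunc {D f : V → ℤ} (hD : IsEffective D)
    (hf : IsEffective (D - lap G f)) (c : ℤ) :
    IsEffective (D - lap G fun v => max (f v - c) 0) := by
  intro v
  have h1 := hD v
  have h2 := hf v
  simp only [Pi.sub_apply, lap] at h2 ⊢
  -- Up to level $c$ a vertex only receives chips; above it, it loses no more than under `f`.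
  rcases le_total (f v) c with h | h
  · have : ∑ w ∈ G.neighborFinset v, (max (f v - c) 0 - max (f w - c) 0) ≤ 0 :=
      Finset.sum_nonpos fun w _ => by omega
    omega
  · have : ∑ w ∈ G.neighborFinset v, (max (f v - c) 0 - max (f w - c) 0)
        ≤ ∑ w ∈ G.neighborFinset v, (f v - f w) :=
      Finset.sum_le_sum fun w _ => by omega
    omega

/-- Lowering the truncation level by one fires a superlevel set of `f` once. -/
lemma trunc_step (D f : V → ℤ) (c : ℤ) :
    (D - lap G fun v => max (f v - c) 0) = (D - lap G fun v => max (f v - (c + 1)) 0)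
      - lap G fun w => if w ∈ Finset.univ.filter (fun v => c < f v) then 1 else 0 := by
  rw [sub_sub, ← lap_add]
  congr 2
  funext v
  simp only [Pi.add_apply, Finset.mem_filter, Finset.mem_univ, true_and]
  split_ifs <;> omega

/-- A predicate on `ℕ` that fails at `0` and holds at `m` is switched on at some step, before
which it fails. -/
lemma exists_first_step {P : ℕ → Prop} (h0 : ¬ P 0) {m : ℕ} (hm : P m) :
    ∃ i < m, ¬ P i ∧ P (i + 1) := by
  by_contra! h
  have : ∀ i ≤ m, ¬ P i := fun i => by
    induction i with
    | zero => exact fun _ => h0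
    | succ i ih => exact fun hi => h i (by omega) (ih (by omega))
  exact this m le_rfl hm

lemma order_le_divisorDegree (S : Scramble G) {D : V → ℤ} (hreach : ReachesAll G D) {d : ℕ}
    (hd : divisorDegree D = d) : S.order ≤ d := by
  classical
  by_cases hV : S.eggs = ∅
  · have : S.hittingNumber ≤ ((∅ : Finset V).card : ℕ∞) :=
      iInf₂_le (∅ : Finset V) (fun E hE => by simp [hV] at hE)
    exact (min_le_left _ _).trans (this.trans (by simp))
  obtain ⟨E₀, hE₀⟩ := Finset.nonempty_iff_ne_empty.2 hV
  obtain ⟨⟨v₀, -⟩⟩ := (S.connected_of_mem E₀ hE₀).nonempty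
  let P : (V → ℤ) → Prop := fun D => IsEffective D ∧ ReachesAll G D ∧ divisorDegree D = d
  let hits : (V → ℤ) → Finset (Finset V) := fun D => S.eggs.filter (Hits D)
  -- Extremal choice: a divisor meeting as many eggs as possible.
  obtain ⟨D, ⟨hD, hreach, hd⟩, hmax⟩ : ∃ D, P D ∧ ∀ D', P D' → (hits D').card ≤ (hits D).card := by
    have hne : {D | P D}.Nonempty := by
      obtain ⟨f, hf, -⟩ := hreach v₀
      exact ⟨_, hf, hreach.sub_lap G f, by rw [divisorDegree_sub_lap, hd]⟩
    obtain ⟨D, hD, hmin⟩ :=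
      (measure fun D : V → ℤ => S.eggs.card - (hits D).card).wf.has_min _ hne
    refine ⟨D, hD, fun D' hD' => ?_⟩
    have h1 := hmin D' hD'
    have h2 : (hits D').card ≤ S.eggs.card := Finset.card_filter_le _ _
    have h3 : ¬ (S.eggs.card - (hits D').card < S.eggs.card - (hits D).card) := h1
    omega
  by_cases hall : ∀ E ∈ S.eggs, Hits D E
  · refine (min_le_left _ _).trans ?_
    have hC : S.IsHittingSet (Finset.univ.filter fun v => 0 < D v) := fun E hE => by
      obtain ⟨v, hv, hv'⟩ := hall E hE
      exact ⟨v, by simp [hv, hv']⟩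
    refine (iInf₂_le _ hC).trans ?_
    have : ((Finset.univ.filter fun v => 0 < D v).card : ℤ) ≤ d := by
      rw [← hd, Finset.card_filter, Nat.cast_sum]
      refine Finset.sum_le_sum fun v _ => ?_
      have := hD v
      split_ifs <;> push_cast <;> omega
    exact_mod_cast this
  push Not at hall
  obtain ⟨E, hE, hDE⟩ := hall
  obtain ⟨⟨v, hvE⟩⟩ := (S.connected_of_mem E hE).nonempty
  obtain ⟨f, hf, hfv⟩ := hreach v
  obtain ⟨M, hM⟩ : ∃ M : ℤ, ∀ v, f v ≤ M := by
    obtain ⟨M, hM⟩ := (Set.finite_range f).bddAbove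
    exact ⟨M, fun v => hM ⟨v, rfl⟩⟩
  obtain ⟨m, hm⟩ : ∃ m : ℤ, ∀ v, m ≤ f v := by
    obtain ⟨m, hm⟩ := (Set.finite_range f).bddBelow
    exact ⟨m, fun v => hm ⟨v, rfl⟩⟩
  -- A chain of effective divisors from `D` to `D - lap G f`; its steps fire sets `U i` that
  -- increase with `i`.
  let F : ℕ → V → ℤ := fun i => D - lap G fun v => max (f v - (M - i)) 0
  let U : ℕ → Finset V := fun i => Finset.univ.filter fun v => M - (i + 1 : ℕ) < f v
  have hF : ∀ i, IsEffective (F i) := fun i => isEffective_sub_lap_trunc hD hf _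
  have hstep : ∀ i, F (i + 1) = F i - lap G fun w => if w ∈ U i then 1 else 0 := fun i => by
    have := trunc_step (G := G) D f (M - (i + 1 : ℕ))
    rw [show M - ((i + 1 : ℕ) : ℤ) + 1 = M - i by push_cast; ring] at this
    exact this
  have hF0 : F 0 = D := by
    have : (fun v => max (f v - (M - (0 : ℕ))) 0) = 0 := by
      funext v
      have := hM v
      simp
      omega
    simp only [F, this, lap_zero, sub_zero]
  have hlast : F (M - m).toNat = D - lap G f := by
    have : (fun v => max (f v - (M - ((M - m).toNat : ℕ))) 0) = f + fun _ => -m := by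
      funext v
      have := hM v
      have := hm v
      simp only [Pi.add_apply]
      omega
    simp only [F, this, lap_add, lap_const, add_zero]
  obtain ⟨j, -, hj, hj'⟩ := exists_first_step (P := fun i => Hits (F i) E) (by rwa [hF0])
    (m := (M - m).toNat) ⟨v, hvE, by rw [hlast]; omega⟩
  -- By maximality, gaining `E` must cost some egg that `D` met.
  obtain ⟨E', hE', hDE', hjE'⟩ : ∃ E' ∈ S.eggs, Hits D E' ∧ ¬ Hits (F (j + 1)) E' := by
    by_contra! hcon
    have h1 := hmax (F (j + 1)) ⟨hF _, hreach.sub_lap G _, by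
      simp only [F]; rw [divisorDegree_sub_lap, hd]⟩
    have h2 : hits D ⊂ hits (F (j + 1)) := by
      refine Finset.ssubset_iff_of_subset (fun E' h => ?_) |>.2 ⟨E, ?_, ?_⟩
      · obtain ⟨h3, h4⟩ := Finset.mem_filter.1 h
        exact Finset.mem_filter.2 ⟨h3, hcon E' h3 h4⟩
      · exact Finset.mem_filter.2 ⟨hE, hj'⟩
      · exact fun h => hDE (Finset.mem_filter.1 h).2
    exact absurd (Finset.card_lt_card h2) (by omega)
  obtain ⟨i, hij, hi, hi'⟩ := exists_first_step (P := fun i => ¬ Hits (F i) E')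
    (by rw [hF0]; exact not_not.2 hDE') hjE'
  have hEj := notMem_of_gains (hF j) (U := U j) (by rw [← hstep]; exact hF _)
    (S.connected_of_mem E hE) hj (by rw [← hstep]; exact hj')
  have hEi := mem_of_loses (hF i) (U := U i) (by rw [← hstep]; exact hF _)
    (S.connected_of_mem E' hE') (not_not.1 hi) (by rw [← hstep]; exact hi')
  -- `E'` is lost at a step $i\le j$, hence lies in `U i`, while `E` avoids `U j`, which contains `U
  -- i`.
  have hcut : S.IsEggCut (U i) := by
    refine ⟨⟨E', hE', hEi⟩, E, hE, fun w hw => Finset.mem_compl.2 fun hwU => hEj w hw ?_⟩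
    simp only [U, Finset.mem_filter, Finset.mem_univ, true_and] at hwU ⊢
    push_cast at hwU ⊢
    omega
  refine (min_le_right _ _).trans ((iInf₂_le _ hcut).trans ?_)
  have h1 := card_interedges_le_divisorDegree (hF i) (U := U i) (by rw [← hstep]; exact hF _)
  rw [show divisorDegree (F i) = d by simp only [F]; rw [divisorDegree_sub_lap, hd]] at h1
  exact_mod_cast h1

end ScrambleBound

/-! ### Component independent sets. -/

section ComponentIndependent

variable {G : SimpleGraph V}

lemma IsComponentIndependent.neighbor_unique {S : Finset V} (hS : IsComponentIndependent G 2 S)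
    {v w x : V} (hv : v ∈ S) (hw : w ∈ S) (hx : x ∈ S) (hvw : G.Adj v w) (hvx : G.Adj v x) :
    w = x := by
  by_contra hwx
  let C := (G.induce (S : Set V)).connectedComponentMk ⟨v, hv⟩
  have hsub : ({⟨v, hv⟩, ⟨w, hw⟩, ⟨x, hx⟩} : Set (S : Set V)) ⊆ C.supp := by
    rintro y (rfl | rfl | rfl)
    · rfl
    · exact SimpleGraph.ConnectedComponent.sound
        (SimpleGraph.Adj.reachable (by simpa using hvw.symm))
    · exact SimpleGraph.ConnectedComponent.sound
        (SimpleGraph.Adj.reachable (by simpa using hvx.symm))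
  have h1 := Set.ncard_le_ncard hsub (Set.toFinite _)
  have h2 := Set.ncard_eq_three.2 ⟨(⟨v, hv⟩ : (S : Set V)), ⟨w, hw⟩, ⟨x, hx⟩,
    by simpa using hvw.ne, by simpa using hvx.ne, by simpa using hwx, rfl⟩
  have := hS C
  omega

lemma exists_card_eq_componentIndepNumber (G : SimpleGraph V) (ℓ : ℕ) :
    ∃ S, IsComponentIndependent G ℓ S ∧ S.card = componentIndepNumber G ℓ := by
  classical
  have hne : (Finset.univ.filter fun S : Finset V => IsComponentIndependent G ℓ S).Nonempty := by
    refine ⟨∅, Finset.mem_filter.2 ⟨Finset.mem_univ _, fun C => ?_⟩⟩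
    obtain ⟨⟨v, hv⟩, -⟩ := C.nonempty_supp
    simp at hv
  obtain ⟨S, hS, h⟩ := Finset.exists_mem_eq_sup _ hne Finset.card
  refine ⟨S, (Finset.mem_filter.1 hS).2, ?_⟩
  rw [componentIndepNumber, ← h]

lemma IsComponentIndependent.card_le {ℓ : ℕ} {S : Finset V} (hS : IsComponentIndependent G ℓ S) :
    S.card ≤ componentIndepNumber G ℓ := by
  classical
  unfold componentIndepNumber
  exact Finset.le_sup (f := Finset.card) (Finset.mem_filter.2 ⟨Finset.mem_univ _, hS⟩)

lemma isComponentIndependent_of_isIndep {S : Finset V}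
    (hS : ∀ v ∈ S, ∀ w ∈ S, ¬ G.Adj v w) : IsComponentIndependent G 2 S := by
  intro C
  refine le_trans ((Set.ncard_le_one_iff (Set.toFinite _)).2 fun {a b} ha hb => ?_) one_le_two
  have hab : (G.induce (S : Set V)).Reachable a b :=
    SimpleGraph.ConnectedComponent.exact (ha.trans hb.symm)
  have hbot : G.induce (S : Set V) = ⊥ := by
    ext x y
    simpa using hS x x.2 y y.2
  rw [hbot, SimpleGraph.reachable_bot] at hab
  exact hab

end ComponentIndependent

/-! ### The gonality is at most $n-\alpha_2^c(G)$. -/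

section UpperBound

variable {G : SimpleGraph V} [DecidableRel G.Adj]

/-- In a connected triangle-free graph with at least three vertices, one chip on every vertex
outside of a `2`-component independent set gives a divisor of positive rank. -/
lemma reachesAll_indicator_compl (hconn : G.Connected) (hn : 3 ≤ Fintype.card V)
    (htri : ∀ u v w, G.Adj u v → G.Adj v w → ¬ G.Adj u w)
    {S : Finset V} (hS : IsComponentIndependent G 2 S) :
    ReachesAll G (fun v => if v ∈ S then 0 else 1) := by
  have : Nontrivial V := Fintype.one_lt_card_iff_nontrivial.1 (by omega)
  have hdeg : ∀ v, 0 < G.degree v := fun v => hconn.preconnected.degree_pos_of_nontrivial v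
  intro v
  by_cases hv : v ∈ S
  swap
  · refine ⟨0, ?_, ?_⟩
    · intro w
      rw [lap_zero, sub_zero]
      split_ifs <;> norm_num
    · rw [lap_zero, sub_zero]
      simp [hv]
  by_cases hw : ∃ w ∈ S, G.Adj v w
  · obtain ⟨w, hwS, hvw⟩ := hw
    have hvu : ∀ x ∈ S, G.Adj v x → x = w := fun x hx h => hS.neighbor_unique hv hx hwS h hvw
    have hwu : ∀ x ∈ S, G.Adj w x → x = v := fun x hx h =>
      hS.neighbor_unique hwS hx hv h hvw.symm
    -- Firing the complement of $\{v,w\}$ gives $v$ exactly $\mathrm{val}(v)-1$ chips, which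
    -- suffices unless $v$ is a leaf.
    by_cases hd : 2 ≤ G.degree v
    · have hval : ∀ x, ((fun v => if v ∈ S then 0 else 1 : V → ℤ)
          - lap G (-(Pi.single v 1 + Pi.single w 1))) x
          = (if x ∈ S then 0 else 1) + lap G (Pi.single v 1) x + lap G (Pi.single w 1) x := by
        intro x
        rw [lap_neg, lap_add]
        simp only [Pi.sub_apply, Pi.neg_apply, Pi.add_apply]
        ring
      have hvv : 1 ≤ ((fun v => if v ∈ S then 0 else 1 : V → ℤ)
          - lap G (-(Pi.single v 1 + Pi.single w 1))) v := by
        rw [hval, lap_single_self, lap_single_of_ne G hvw.ne]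
        simp only [hv, hvw.symm, if_true]
        omega
      refine ⟨_, fun x => ?_, hvv⟩
      by_cases hxv : x = v
      · rw [hxv]; omega
      rw [hval, lap_single_of_ne G hxv]
      by_cases hxw : x = w
      · subst hxw
        rw [lap_single_self]
        have := hdeg x
        simp only [hwS, hvw, if_true]
        omega
      rw [lap_single_of_ne G hxw]
      by_cases hxS : x ∈ S
      · have h1 : ¬ G.Adj v x := fun h => hxw (hvu x hxS h)
        have h2 : ¬ G.Adj w x := fun h => hxv (hwu x hxS h)
        simp [h1, h2, hxS]
      · have h3 := htri v w x hvw
        by_cases h1 : G.Adj v x <;> by_cases h2 : G.Adj w x <;> simp [h1, h2, hxS] <;> tauto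
    · have hv1 : G.degree v = 1 := by have := hdeg v; omega
      have honly : ∀ x, G.Adj v x → x = w := fun x hx =>
        (Finset.card_le_one.1 (by rw [G.card_neighborFinset_eq_degree, hv1]))
          x (by simpa using hx) w (by simpa using hvw)
      -- Otherwise $\{v,w\}$ would be a whole component of $G$.
      have hw2 : 2 ≤ G.degree w := by
        by_contra hlt
        have hw1 : G.degree w = 1 := by have := hdeg w; omega
        have honly' : ∀ x, G.Adj w x → x = v := fun x hx =>
          (Finset.card_le_one.1 (by rw [G.card_neighborFinset_eq_degree, hw1]))
            x (by simpa using hx) v (by simpa using hvw.symm)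
        have hex : ∃ x, x ∉ ({v, w} : Finset V) := by
          by_contra! hcon
          have := Finset.card_le_card (fun x _ => hcon x : Finset.univ ⊆ ({v, w} : Finset V))
          have h2 : ({v, w} : Finset V).card ≤ 2 := Finset.card_le_two
          rw [Finset.card_univ] at this
          omega
        obtain ⟨x, hx⟩ := hex
        obtain ⟨p⟩ := hconn.preconnected v x
        obtain ⟨d, -, h1, h2⟩ := p.exists_boundary_dart (({v, w} : Finset V) : Set V)
          (by simp) (by exact_mod_cast hx)
        have hadj := d.adj
        simp only [Finset.coe_insert, Finset.coe_singleton, Set.mem_insert_iff,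
          Set.mem_singleton_iff, not_or] at h1 h2
        rcases h1 with h1 | h1
        · exact h2.2 (honly _ (h1 ▸ hadj))
        · exact h2.1 (honly' _ (h1 ▸ hadj))
      -- For a leaf $v$, fire the complement of $\{v,w\}$ and then that of $\{v\}$: $w$ gains
      -- $\mathrm{val}(w)-1\ge1$ chips and passes one on.
      have hval : ∀ x, ((fun v => if v ∈ S then 0 else 1 : V → ℤ)
          - lap G (-(Pi.single v 1 + Pi.single v 1 + Pi.single w 1))) x
          = (if x ∈ S then 0 else 1) + 2 * lap G (Pi.single v 1) x + lap G (Pi.single w 1) x := by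
        intro x
        rw [lap_neg, lap_add, lap_add]
        simp only [Pi.sub_apply, Pi.neg_apply, Pi.add_apply]
        ring
      have hvv : 1 ≤ ((fun v => if v ∈ S then 0 else 1 : V → ℤ)
          - lap G (-(Pi.single v 1 + Pi.single v 1 + Pi.single w 1))) v := by
        rw [hval, lap_single_self, lap_single_of_ne G hvw.ne]
        simp only [hv, hvw.symm, if_true]
        omega
      refine ⟨_, fun x => ?_, hvv⟩
      by_cases hxv : x = v
      · rw [hxv]; omega
      rw [hval, lap_single_of_ne G hxv]
      by_cases hxw : x = w
      · subst hxw
        rw [lap_single_self]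
        simp only [hwS, hvw, if_true]
        omega
      rw [lap_single_of_ne G hxw]
      have h1 : ¬ G.Adj v x := fun h => hxw (honly x h)
      by_cases hxS : x ∈ S
      · have h2 : ¬ G.Adj w x := fun h => hxv (hwu x hxS h)
        simp [h1, h2, hxS]
      · by_cases h2 : G.Adj w x <;> simp [h1, h2, hxS]
  · push Not at hw
    have hval : ∀ x, ((fun v => if v ∈ S then 0 else 1 : V → ℤ) - lap G (-Pi.single v 1)) x
        = (if x ∈ S then 0 else 1) + lap G (Pi.single v 1) x := by
      intro x
      rw [lap_neg]
      simp only [Pi.sub_apply, Pi.neg_apply]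
      ring
    have hvv : 1 ≤ ((fun v => if v ∈ S then 0 else 1 : V → ℤ) - lap G (-Pi.single v 1)) v := by
      rw [hval, lap_single_self]
      have := hdeg v
      simp only [hv, if_true]
      omega
    refine ⟨_, fun x => ?_, hvv⟩
    by_cases hxv : x = v
    · rw [hxv]; omega
    rw [hval, lap_single_of_ne G hxv]
    by_cases hxS : x ∈ S
    · simp [hxS, hw x hxS]
    · by_cases h : G.Adj v x <;> simp [hxS, h]

/-- Besides bounding the gonality, this shows that the infimum defining it is attained. -/
lemma card_sub_componentIndepNumber_mem (hconn : G.Connected) (hn : 3 ≤ Fintype.card V)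
    (htri : ∀ u v w, G.Adj u v → G.Adj v w → ¬ G.Adj u w) :
    Fintype.card V - componentIndepNumber G 2 ∈
      {d : ℕ | ∃ D : V → ℤ, divisorDegree D = d ∧ 0 < divisorRank G D} := by
  have : Nonempty V := hconn.nonempty
  obtain ⟨S, hS, hcard⟩ := exists_card_eq_componentIndepNumber G 2
  refine ⟨_, ?_, rank_pos_of_reachesAll G (reachesAll_indicator_compl hconn hn htri hS)⟩
  rw [← hcard, ← Finset.card_compl, divisorDegree, Finset.card_eq_sum_ones, Nat.cast_sum,
    ← Finset.sum_subset (Finset.subset_univ Sᶜ)]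
  · refine Finset.sum_congr rfl fun v hv => ?_
    simp [Finset.mem_compl.1 hv]
  · intro v _ hv
    simpa using hv

end UpperBound

/-! ### A scramble of order at least $n-\alpha_2^c(G)$. -/

section LowerBound

variable {G : SimpleGraph V} [DecidableRel G.Adj]

open Classical in
/-- The scramble of all connected sets with at least `m` vertices. -/
noncomputable def largeScramble (G : SimpleGraph V) (m : ℕ) : Scramble G where
  eggs := Finset.univ.filter fun E : Finset V => (G.induce (E : Set V)).Connected ∧ m ≤ E.card
  connected_of_mem := fun _ hE => (Finset.mem_filter.1 hE).2.1

lemma mem_largeScramble {m : ℕ} {E : Finset V} :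
    E ∈ (largeScramble G m).eggs ↔ (G.induce (E : Set V)).Connected ∧ m ≤ E.card := by
  simp [largeScramble]

/-- A component of $G[C^c]$ with more than $\ell$ vertices would be an egg missed by $C$. -/
lemma isComponentIndependent_compl_of_isHittingSet {ℓ : ℕ} {C : Finset V}
    (hC : (largeScramble G (ℓ + 1)).IsHittingSet C) : IsComponentIndependent G ℓ Cᶜ := by
  classical
  intro K
  by_contra! hlt
  let E : Finset V := (Subtype.val '' K.supp).toFinset
  have hE : (E : Set V) = Subtype.val '' K.supp := by simp [E]
  have hcard : E.card = K.supp.ncard := by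
    rw [← Set.ncard_coe_finset, hE, Set.ncard_image_of_injective _ Subtype.val_injective]
  have hEconn : (G.induce (E : Set V)).Connected := by
    rw [hE]
    let φ : K.toSimpleGraph →g G.induce (Subtype.val '' K.supp) :=
      ⟨fun x => ⟨x.1.1, x.1, x.2, rfl⟩, fun {a b} h => h⟩
    refine K.connected_toSimpleGraph.map φ ?_
    rintro ⟨_, x, hx, rfl⟩
    exact ⟨⟨x, hx⟩, rfl⟩
  obtain ⟨v, hv⟩ := hC E (mem_largeScramble.2 ⟨hEconn, by omega⟩)
  obtain ⟨h1, h2⟩ := Finset.mem_inter.1 hv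
  have h3 : v ∈ (E : Set V) := h2
  rw [hE] at h3
  obtain ⟨x, -, rfl⟩ := h3
  have := x.2
  simp [h1] at this

/-- A set of at least two vertices whose pairwise degree sums are at least `2k+3` has degree sum
only one less than if all degrees were `k+2`. -/
lemma card_mul_le_sum_add_one {T : Finset V} {d : V → ℕ} {k : ℕ} (hT : 2 ≤ T.card)
    (h : ∀ u ∈ T, ∀ v ∈ T, u ≠ v → 2 * k + 3 ≤ d u + d v) :
    T.card * (k + 2) ≤ ∑ v ∈ T, d v + 1 := by
  -- At most one vertex is this low; pairing it with any other loses only one against $2(k+2)$.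
  by_cases hlow : ∃ u ∈ T, d u ≤ k + 1
  · obtain ⟨u, hu, hdu⟩ := hlow
    have hc : (T.erase u).card + 1 = T.card := Finset.card_erase_add_one hu
    obtain ⟨v, hv⟩ : (T.erase u).Nonempty := Finset.card_pos.1 (by omega)
    have hc' : ((T.erase u).erase v).card + 1 = (T.erase u).card := Finset.card_erase_add_one hv
    have hrest : ((T.erase u).erase v).card * (k + 2) ≤ ∑ w ∈ (T.erase u).erase v, d w := by
      rw [← smul_eq_mul]
      refine Finset.card_nsmul_le_sum _ _ _ fun w hw => ?_
      have hw' := Finset.mem_of_mem_erase hw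
      have := h u hu w (Finset.mem_of_mem_erase hw') (Finset.ne_of_mem_erase hw').symm
      omega
    have huv := h u hu v (Finset.mem_of_mem_erase hv) (Finset.ne_of_mem_erase hv).symm
    rw [← Finset.add_sum_erase T d hu, ← Finset.add_sum_erase _ d hv, ← hc, ← hc']
    have : (((T.erase u).erase v).card + 1 + 1) * (k + 2)
        = ((T.erase u).erase v).card * (k + 2) + (2 * k + 4) := by ring
    omega
  · push Not at hlow
    have : T.card * (k + 2) ≤ ∑ v ∈ T, d v := by
      rw [← smul_eq_mul]
      exact Finset.card_nsmul_le_sum _ _ _ fun w hw => hlow w hw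
    omega

lemma sum_degree_le_of_forall_adj_mem {T X Y : Finset V}
    (h : ∀ v ∈ T, ∀ w ∈ X, G.Adj v w → w ∈ Y) :
    ∑ v ∈ T, G.degree v
      ≤ ∑ v ∈ T, ((G.neighborFinset v).filter (· ∉ X)).card + T.card * Y.card := by
  rw [← smul_eq_mul, ← Finset.sum_const, ← Finset.sum_add_distrib]
  refine Finset.sum_le_sum fun v hv => ?_
  rw [← G.card_neighborFinset_eq_degree,
    ← Finset.card_filter_add_card_filter_not (s := G.neighborFinset v) (· ∉ X)]
  refine Nat.add_le_add_left (Finset.card_le_card fun w hw => ?_) _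
  simp only [Finset.mem_filter, SimpleGraph.mem_neighborFinset, not_not] at hw
  exact h v hv w hw.2 hw.1

/-- Here $x,y$ are the sizes of the colour classes of $X$ and $a,b$ count the edges leaving $X$ from
each. If $x=1$, then $b\ge y(k+1)-1\ge2k+1$ already. If $x,y\ge2$, add both bounds and use $2xy\le
s^2/2$ and $(s-2)(2k+1-s)\ge0$ with $s=x+y\ge4$. -/
lemma cut_arith {k x y a b : ℕ} (hx : 1 ≤ x) (hy : 1 ≤ y) (hxy : 3 ≤ x + y)
    (hle : x + y ≤ 2 * k + 1)
    (ha : 2 ≤ x → x * (k + 2) ≤ a + x * y + 1) (hb : 2 ≤ y → y * (k + 2) ≤ b + y * x + 1) :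
    2 * k + 1 ≤ a + b := by
  rcases hx.eq_or_lt with rfl | hx2
  · have := hb (by omega)
    nlinarith [Nat.mul_le_mul_right k (show 2 ≤ y by omega)]
  rcases hy.eq_or_lt with rfl | hy2
  · have := ha (by omega)
    nlinarith [Nat.mul_le_mul_right k (show 2 ≤ x by omega)]
  have h1 := ha hx2
  have h2 := hb hy2
  zify at *
  nlinarith [sq_nonneg ((x : ℤ) - y), mul_nonneg (show (0 : ℤ) ≤ x + y - 2 by omega)
    (show (0 : ℤ) ≤ 2 * k + 1 - (x + y) by omega)]

/-- The edge cut around a set with at most half of the vertices. -/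
lemma le_card_interedges_of_card_le (c : G.Coloring (Fin 2))
    (hval : ∀ u v : V, u ≠ v → ¬ G.Adj u v →
      2 * (Fintype.card V / 4) + 3 ≤ G.degree u + G.degree v)
    {X E : Finset V} (hX : 2 * X.card ≤ Fintype.card V)
    (hE : E ∈ (largeScramble G 3).eggs) (hEX : E ⊆ X) :
    2 * (Fintype.card V / 4) + 1 ≤ (G.interedges X Xᶜ).card := by
  obtain ⟨hconn, hcard⟩ := mem_largeScramble.1 hE
  obtain ⟨u, hu, v, hv, huv⟩ := Finset.one_lt_card.1 (show 1 < E.card by omega)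
  -- An edge inside the egg shows that $X$ meets both colour classes.
  obtain ⟨a, ha, b, hb, -, -, hab⟩ := exists_adj_of_connected G hconn (U := {u}) hu rfl hv huv.symm
  let T : Fin 2 → Finset V := fun i => X.filter fun w => c w = i
  have hT : ∀ i, 1 ≤ (T i).card := fun i => by
    have hne := c.valid hab
    rcases (by omega : c a = i ∨ c b = i) with h | h
    · exact Finset.card_pos.2 ⟨a, Finset.mem_filter.2 ⟨hEX ha, h⟩⟩
    · exact Finset.card_pos.2 ⟨b, Finset.mem_filter.2 ⟨hEX hb, h⟩⟩
  have hfilter : X.filter (fun w => ¬ c w = 0) = T 1 :=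
    Finset.filter_congr fun w _ => by omega
  have hsum : (T 0).card + (T 1).card = X.card := by
    rw [← hfilter]
    exact Finset.card_filter_add_card_filter_not _
  have hcut := card_interedges_compl G X
  rw [← Finset.sum_filter_add_sum_filter_not X (fun w => c w = 0), hfilter] at hcut
  rw [hcut]
  have hside : ∀ i j, i ≠ j → 2 ≤ (T i).card →
      (T i).card * (Fintype.card V / 4 + 2)
        ≤ ∑ v ∈ T i, ((G.neighborFinset v).filter (· ∉ X)).card + (T i).card * (T j).card + 1 := by
    intro i j hij h2
    -- Vertices of one colour are non-adjacent, so the valence condition applies to all pairs in `T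
    -- i`.
    have h3 := card_mul_le_sum_add_one (T := T i) (d := fun v => G.degree v) h2
      fun u hu v hv huv => hval u v huv fun hadj => c.valid hadj
        ((Finset.mem_filter.1 hu).2.trans (Finset.mem_filter.1 hv).2.symm)
    have h4 := sum_degree_le_of_forall_adj_mem (G := G) (T := T i) (X := X) (Y := T j)
      fun v hv w hw hadj => by
        have h5 := c.valid hadj
        have h6 := (Finset.mem_filter.1 hv).2
        exact Finset.mem_filter.2 ⟨hw, by omega⟩
    omega
  have := Finset.card_le_card hEX
  exact cut_arith (x := (T 0).card) (y := (T 1).card) (hT 0) (hT 1) (by omega)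
    (by omega) (hside 0 1 (by decide)) (hside 1 0 (by decide))

lemma card_interedges_compl_comm (X : Finset V) :
    (G.interedges Xᶜ Xᶜᶜ).card = (G.interedges X Xᶜ).card := by
  have := G.symm
  rw [compl_compl]
  exact Rel.card_interedges_comm Xᶜ X

lemma le_order_largeScramble (hbip : G.IsBipartite)
    (hval : ∀ u v : V, u ≠ v → ¬ G.Adj u v →
      2 * (Fintype.card V / 4) + 3 ≤ G.degree u + G.degree v) :
    ((Fintype.card V - componentIndepNumber G 2 : ℕ) : ℕ∞) ≤ (largeScramble G 3).order := by
  obtain ⟨c⟩ := hbip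
  refine le_min (le_iInf₂ fun C hC => ?_) (le_iInf₂ fun X hX => ?_)
  · have h1 := (isComponentIndependent_compl_of_isHittingSet hC).card_le
    rw [Finset.card_compl] at h1
    exact_mod_cast (by omega : Fintype.card V - componentIndepNumber G 2 ≤ C.card)
  · have hside : ∀ i, (Finset.univ.filter fun v => c v = i).card ≤ componentIndepNumber G 2 :=
      fun i => (isComponentIndependent_of_isIndep fun v hv w hw hadj => c.valid hadj
        ((Finset.mem_filter.1 hv).2.trans (Finset.mem_filter.1 hw).2.symm)).card_le
    have h0 := hside 0
    have h1 := hside 1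
    have h2 : (Finset.univ.filter fun v => c v = 0).card
        + (Finset.univ.filter fun v => c v = 1).card = Fintype.card V := by
      rw [← Finset.card_univ,
        ← Finset.card_filter_add_card_filter_not (s := Finset.univ) fun v => c v = 0]
      congr 2
      exact Finset.filter_congr fun w _ => by omega
    obtain ⟨⟨E, hE, hEX⟩, E', hE', hEX'⟩ := hX
    have h3 : 2 * (Fintype.card V / 4) + 1 ≤ (G.interedges X Xᶜ).card := by
      -- Both sides contain an egg, so the cut may be viewed from the side with at most half of the
      -- vertices.
      have hc := Finset.card_compl X
      have hc' := Finset.card_le_univ X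
      rcases le_total (2 * X.card) (Fintype.card V) with h | h
      · exact le_card_interedges_of_card_le c hval h hE hEX
      · rw [← card_interedges_compl_comm]
        exact le_card_interedges_of_card_le c hval (by omega) hE' hEX'
    exact_mod_cast
      (by omega : Fintype.card V - componentIndepNumber G 2 ≤ (G.interedges X Xᶜ).card)

end LowerBound

end GraphGonality

theorem mainTheorem8 {V : Type*} [Fintype V] [DecidableEq V]
    (G : SimpleGraph V) [DecidableRel G.Adj]
    (hconn : G.Connected) (hbip : G.IsBipartite) (hn : 6 ≤ Fintype.card V)
    (hval : ∀ u v : V, u ≠ v → ¬ G.Adj u v →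
      2 * (Fintype.card V / 4) + 3 ≤ G.degree u + G.degree v) :
    GraphGonality.scrambleNumber G = (GraphGonality.gonality G : ℕ∞) ∧
      GraphGonality.gonality G =
        Fintype.card V - GraphGonality.componentIndepNumber G 2 := by
  have htri : ∀ u v w, G.Adj u v → G.Adj v w → ¬ G.Adj u w := by
    obtain ⟨c⟩ := hbip
    intro u v w huv hvw huw
    have h1 := c.valid huv
    have h2 := c.valid hvw
    have h3 := c.valid huw
    omega
  have hmem := GraphGonality.card_sub_componentIndepNumber_mem hconn (by omega) htri
  have hle : GraphGonality.gonality G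
      ≤ Fintype.card V - GraphGonality.componentIndepNumber G 2 := Nat.sInf_le hmem
  have hsn : GraphGonality.scrambleNumber G ≤ (GraphGonality.gonality G : ℕ∞) := by
    obtain ⟨D, hD, hrank⟩ := Nat.sInf_mem ⟨_, hmem⟩
    exact iSup_le fun S =>
      GraphGonality.order_le_divisorDegree S (GraphGonality.reachesAll_of_rank_pos G hrank) hD
  have hge : ((Fintype.card V - GraphGonality.componentIndepNumber G 2 : ℕ) : ℕ∞)
      ≤ GraphGonality.scrambleNumber G :=
    (GraphGonality.le_order_largeScramble hbip hval).trans
      (le_iSup (fun S : GraphGonality.Scramble G => S.order) _)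
  have heq : GraphGonality.gonality G
      = Fintype.card V - GraphGonality.componentIndepNumber G 2 :=
    le_antisymm hle (by exact_mod_cast hge.trans hsn)
  exact ⟨le_antisymm hsn (heq ▸ hge), heq⟩
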